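/- Conventions. A topological groupoid $G$ is a small category in which every morphism is invertible, identified with its set of morphisms, which carries a topology making multiplication (on the space of composable pairs $\{(x,y)\in G\times G : d(x)=r(y)\}$) and inversion continuous. Here $d$ and $r$ denote the domain and range maps onto the set $G^0\subseteq G$ of units, and $G^u=r^{-1}(\{u\})$ for $u\in G^0$; the subsets $G^0$ and $G^u$ have the relative topology. For a topological space $Y$, $C_c(Y)$ is the linear span of the functions $f\colon Y\to\mathbb{C}$ for which there is a Hausdorff open set $U\subseteq Y$ such that $f$ vanishes outside $U$ and $f|_U$ is continuous with compact support in $U$. A (left) Haar system on $G$ is a family $\{\lambda^u\}_{u\in G^0}$, where $\lambda^u$ is a positive regular Borel measure on $G^u$ with support $G^u$, such that for every $g\in C_c(G)$ the function $u\mapsto\int_{G^u} g\,d\lambda^u$ belongs to $C_c(G^0)$, and for all $x\in G$ and $f\in C_c(G)$ \[\int_{G^{d(x)}} f(xz)\,d\lambda^{d(x)}(z)=\int_{G^{r(x)}} f(y)\,d\lambda^{r(x)}(y).\] A topological groupoid $G$ is locally compact if $G^0$ and every $G^u$ are locally compact Hausdorff, there is a countable family of compact Hausdorff subsets of $G$ whose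 interiors form a basis of the topology of $G$, and $G$ admits a Haar system. A map $\pi\colon G\to H$ between topological groupoids is a fiberwise groupoid covering if it is a groupoid homomorphism (it intertwines the unit spaces, $d$, $r$ and the multiplication), it restricts to a homeomorphism $G^0\to H^0$, it is surjective, and it is a local homeomorphism. It intertwines Haar systems $\lambda_G$ and $\lambda_H$ if for every $u\in G^0$ and every open $U\subseteq G$ such that $\pi|_U$ is a homeomorphism onto its image, the push-forward of $\lambda_G^u|_{U\cap G^u}$ under $\pi|_{U\cap G^u}$ equals $\lambda_H^{\pi(u)}|_{\pi(U)\cap H^{\pi(u)}}$. Theorem. Let $G$ and $H$ be topological groupoids and let $\pi\colon G\to H$ be a fiberwise groupoid covering. 1. Suppose that the topology of $G$ has a countable base. If $H$ is a locally compact groupoid with Haar system $\lambda_H$, then $G$ is also locally compact and there is a Haar system $\lambda_G$ on $G$ such that $\pi$ intertwines $\lambda_G$ and $\lambda_H$. 2. If $G$ is a locally compact groupoid with Haar system $\lambda_G$, then $H$ is also locally compact and there is a Haar system $\lambda_H$ on $H$ such that $\pi$ intertwines $\lambda_G$ and $\lambda_H$. -/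

import Mathlib

open Set MeasureTheory TopologicalSpace

noncomputable section

/-- A groupoid in its arrows-only form: `G` is the set of all morphisms of a small category in which
every morphism is invertible, and an object is identified with its identity morphism (a *unit*).
`dom x` and `rng x` are the domain and range units of `x`, and the product `x y` is defined exactly
for the composable pairs, `dom x = rng y`. -/
class AlgGroupoid (G : Type*) where
  dom : G → G
  rng : G → G
  mul : ∀ x y : G, dom x = rng y → G
  inv : G → G
  dom_dom : ∀ x, dom (dom x) = dom x
  rng_dom : ∀ x, rng (dom x) = dom x
  dom_rng : ∀ x, dom (rng x) = rng x
  rng_rng : ∀ x, rng (rng x) = rng x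
  dom_mul : ∀ (x y : G) (h : dom x = rng y), dom (mul x y h) = dom y
  rng_mul : ∀ (x y : G) (h : dom x = rng y), rng (mul x y h) = rng x
  mul_assoc : ∀ (x y z : G) (hxy : dom x = rng y) (hyz : dom y = rng z),
    mul (mul x y hxy) z ((dom_mul x y hxy).trans hyz) =
      mul x (mul y z hyz) (hxy.trans (rng_mul y z hyz).symm)
  rng_mul_self : ∀ x, mul (rng x) x (dom_rng x) = x
  mul_dom_self : ∀ x, mul x (dom x) (rng_dom x).symm = x
  dom_inv : ∀ x, dom (inv x) = rng x
  rng_inv : ∀ x, rng (inv x) = dom x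
  inv_mul_self : ∀ x, mul (inv x) x (dom_inv x) = dom x
  mul_inv_self : ∀ x, mul x (inv x) (rng_inv x).symm = rng x

namespace AlgGroupoid

/-- The unit space `G⁰`, as a subset of `G`. -/
def units (G : Type*) [AlgGroupoid G] : Set G := {u | dom u = u}

theorem dom_mem_units {G : Type*} [AlgGroupoid G] (x : G) : dom x ∈ units G := dom_dom x

theorem rng_mem_units {G : Type*} [AlgGroupoid G] (x : G) : rng x ∈ units G := dom_rng x

/-- The range fibre `G^u = r⁻¹({u})`, with the subspace topology and the subspace σ-algebra. -/
abbrev RFiber {G : Type*} [AlgGroupoid G] (u : G) : Type _ := {x : G // rng x = u}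

end AlgGroupoid

open AlgGroupoid

/-- A topological groupoid: multiplication is continuous on the space of composable pairs (with the
subspace topology of `G × G`) and inversion is continuous. -/
class IsTopGroupoid (G : Type*) [TopologicalSpace G] [AlgGroupoid G] : Prop where
  continuous_mul :
    Continuous fun p : {p : G × G // dom p.1 = rng p.2} => mul p.1.1 p.1.2 p.2
  continuous_inv : Continuous (inv : G → G)

/-- `C_c(Y)₀`: the functions that vanish outside some Hausdorff open set `U` and whose restriction
to `U` is continuous with compact support in `U`. -/
def CcZero (Y : Type*) [TopologicalSpace Y] : Set (Y → ℂ) :=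
  {f | ∃ U : Set Y, IsOpen U ∧ T2Space U ∧ (∀ x, x ∉ U → f x = 0) ∧
    Continuous (fun x : U => f x) ∧ HasCompactSupport (fun x : U => f x)}

/-- `C_c(Y)`: the linear span of `C_c(Y)₀` among all complex-valued functions on `Y`. -/
def Cc (Y : Type*) [TopologicalSpace Y] : Submodule ℂ (Y → ℂ) :=
  Submodule.span ℂ (CcZero Y)

/-- A left Haar system on a topological groupoid: a regular Borel measure on each `G^u`, of full
support, with the continuity and the left invariance properties. -/
structure IsHaarSystem {G : Type*} [TopologicalSpace G] [AlgGroupoid G] [MeasurableSpace G]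
    (lam : ∀ u : units G, Measure (RFiber (u : G))) : Prop where
  regular : ∀ u, (lam u).Regular
  full_support : ∀ u, (lam u).support = Set.univ
  continuous : ∀ g ∈ Cc G, (fun u : units G => ∫ z, g z.1 ∂(lam u)) ∈ Cc (units G)
  left_invariant : ∀ (x : G), ∀ f ∈ Cc G,
    ∫ z, f (mul x z.1 z.2.symm) ∂(lam ⟨dom x, dom_mem_units x⟩) =
      ∫ y, f y.1 ∂(lam ⟨rng x, rng_mem_units x⟩)

/-- A locally compact (locally Hausdorff) groupoid. -/
structure IsLocallyCompactGroupoid (G : Type*) [TopologicalSpace G] [AlgGroupoid G]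
    [MeasurableSpace G] : Prop where
  isTopGroupoid : IsTopGroupoid G
  units_locallyCompact : LocallyCompactSpace (units G)
  units_t2 : T2Space (units G)
  basis : ∃ 𝒞 : Set (Set G), 𝒞.Countable ∧ (∀ C ∈ 𝒞, IsCompact C ∧ T2Space C) ∧
    IsTopologicalBasis (interior '' 𝒞)
  fiber_locallyCompact : ∀ u : units G, LocallyCompactSpace (RFiber (u : G))
  fiber_t2 : ∀ u : units G, T2Space (RFiber (u : G))
  exists_haar : ∃ lam : ∀ u : units G, Measure (RFiber (u : G)), IsHaarSystem lam

/-- A groupoid homomorphism. -/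
structure IsGroupoidHom {G H : Type*} [AlgGroupoid G] [AlgGroupoid H] (π : G → H) : Prop where
  map_dom : ∀ x, π (dom x) = dom (π x)
  map_rng : ∀ x, π (rng x) = rng (π x)
  map_mul : ∀ (x y : G) (h : dom x = rng y),
    π (mul x y h) = mul (π x) (π y) (by rw [← map_dom, h, map_rng])

theorem IsGroupoidHom.mapsTo_units {G H : Type*} [AlgGroupoid G] [AlgGroupoid H] {π : G → H}
    (hπ : IsGroupoidHom π) : MapsTo π (units G) (units H) := fun u hu => by
  change dom (π u) = π u
  rw [← hπ.map_dom, show dom u = u from hu]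

/-- The map `G⁰ → H⁰` induced by a groupoid homomorphism. -/
def IsGroupoidHom.onUnits {G H : Type*} [AlgGroupoid G] [AlgGroupoid H] {π : G → H}
    (hπ : IsGroupoidHom π) : units G → units H := hπ.mapsTo_units.restrict π (units G) (units H)

/-- The map `G^u → H^{π(u)}` induced by a groupoid homomorphism. -/
def IsGroupoidHom.onFiber {G H : Type*} [AlgGroupoid G] [AlgGroupoid H] {π : G → H}
    (hπ : IsGroupoidHom π) (u : units G) : RFiber (u : G) → RFiber (hπ.onUnits u : H) :=
  fun x => ⟨π x.1, by rw [← hπ.map_rng, x.2]; rfl⟩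

/-- A fiberwise groupoid covering map. -/
structure IsFiberwiseGroupoidCovering {G H : Type*} [TopologicalSpace G] [TopologicalSpace H]
    [AlgGroupoid G] [AlgGroupoid H] (π : G → H) : Prop where
  hom : IsGroupoidHom π
  units_homeo : IsHomeomorph hom.onUnits
  surjective : Function.Surjective π
  isLocalHomeomorph : IsLocalHomeomorph π

/-- `π` intertwines the Haar systems: for every unit `u` and every open `U ⊆ G` that `π` maps
homeomorphically onto its image, `π` pushes `λ_G^u` restricted to `U ∩ G^u` forward to
`λ_H^{π(u)}` restricted to `π(U) ∩ H^{π(u)}` (both sides regarded as measures on the whole fibre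
`H^{π(u)}`, null outside `π(U)`). -/
def IntertwinesHaar {G H : Type*} [TopologicalSpace G] [TopologicalSpace H]
    [AlgGroupoid G] [AlgGroupoid H] [MeasurableSpace G] [MeasurableSpace H] {π : G → H}
    (hπ : IsGroupoidHom π) (lamG : ∀ u : units G, Measure (RFiber (u : G)))
    (lamH : ∀ v : units H, Measure (RFiber (v : H))) : Prop :=
  ∀ (u : units G) (U : Set G), IsOpen U → Topology.IsEmbedding (fun x : U => π x) →
    ((lamG u).restrict (Subtype.val ⁻¹' U)).map (hπ.onFiber u) =
      (lamH (hπ.onUnits u)).restrict (Subtype.val ⁻¹' (π '' U))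

end

open AlgGroupoid

noncomputable section

section LocallyPreserves

variable {X Y : Type*} [TopologicalSpace X] [TopologicalSpace Y]

theorem IsLocalHomeomorph.exists_isOpen_injOn {φ : X → Y} (hφ : IsLocalHomeomorph φ) (x : X) :
    ∃ O : Set X, IsOpen O ∧ x ∈ O ∧ InjOn φ O := by
  obtain ⟨e, hx, rfl⟩ := hφ x
  exact ⟨e.source, e.open_source, hx, e.injOn⟩

theorem IsLocalHomeomorph.isOpenEmbedding_domRestrict {φ : X → Y} (hφ : IsLocalHomeomorph φ)
    {O : Set X} (hO : IsOpen O) (hinj : InjOn φ O) :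
    Topology.IsOpenEmbedding (O.domRestrict φ) :=
  .of_continuous_injective_isOpenMap (hφ.continuous.comp continuous_subtype_val)
    (injOn_iff_injective.mp hinj) (hφ.isOpenMap.comp hO.isOpenMap_subtype_val)

theorem TopologicalSpace.exists_seq_isOpen_cover [SecondCountableTopology X] {p : Set X → Prop}
    (hp₀ : p ∅) (hp : ∀ x, ∃ O : Set X, IsOpen O ∧ x ∈ O ∧ p O) :
    ∃ O : ℕ → Set X, (∀ n, IsOpen (O n)) ∧ (∀ n, p (O n)) ∧ ⋃ n, O n = univ := by
  choose O hO hxO hpO using hp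
  obtain ⟨s, hs, hsU⟩ := countable_cover_nhds fun x => (hO x).mem_nhds (hxO x)
  obtain ⟨f, hf⟩ := ((hs.image O).insert ∅).exists_eq_range ⟨∅, mem_insert _ _⟩
  have key : ∀ n, IsOpen (f n) ∧ p (f n) := fun n => by
    rcases (hf ▸ mem_range_self n : f n ∈ insert ∅ (O '' s)) with h | ⟨x, -, h⟩
    · rw [h]; exact ⟨isOpen_empty, hp₀⟩
    · rw [← h]; exact ⟨hO x, hpO x⟩
  refine ⟨f, fun n => (key n).1, fun n => (key n).2, eq_univ_of_forall fun x => ?_⟩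
  obtain ⟨y, hy, hxy⟩ := mem_iUnion₂.mp (hsU ▸ mem_univ x)
  obtain ⟨n, hn⟩ := (hf ▸ mem_insert_of_mem _ (mem_image_of_mem O hy) : O y ∈ range f)
  exact mem_iUnion.mpr ⟨n, hn ▸ hxy⟩

variable [MeasurableSpace X] [MeasurableSpace Y]

theorem IsLocalHomeomorph.measurableSet_image [BorelSpace X] [BorelSpace Y] {φ : X → Y}
    (hφ : IsLocalHomeomorph φ) {O : Set X} (hO : IsOpen O) (hinj : InjOn φ O) {E : Set X}
    (hE : MeasurableSet E) (hEO : E ⊆ O) : MeasurableSet (φ '' E) := by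
  have h := (hφ.isOpenEmbedding_domRestrict hO hinj).measurableEmbedding.measurableSet_image'
    (measurable_subtype_coe hE)
  rwa [Set.domRestrict_eq, image_comp, Subtype.image_preimage_coe, inter_eq_right.mpr hEO] at h

/-- `φ` carries the restriction of `μ` to any open set on which it is injective to the restriction
of `ν` to the image. -/
def LocallyPreserves (φ : X → Y) (μ : Measure X) (ν : Measure Y) : Prop :=
  ∀ O : Set X, IsOpen O → InjOn φ O → (μ.restrict O).map φ = ν.restrict (φ '' O)

theorem MeasureTheory.Measure.restrict_eq_of_forall_exists_nhds [SecondCountableTopology X]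
    {μ ν : Measure X} {S : Set X}
    (h : ∀ x ∈ S, ∃ W : Set X, IsOpen W ∧ x ∈ W ∧ μ.restrict W = ν.restrict W) :
    μ.restrict S = ν.restrict S := by
  choose! W hW hxW hμν using h
  obtain ⟨t, htS, htc, hSt⟩ := countable_cover_nhdsWithin
    fun x hx => mem_nhdsWithin_of_mem_nhds ((hW x hx).mem_nhds (hxW x hx))
  exact Measure.restrict_congr_mono hSt
    ((Measure.restrict_biUnion_congr htc).mpr fun x hx => hμν x (htS hx))

theorem MeasureTheory.Measure.ext_of_forall_exists_nhds [SecondCountableTopology X]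
    {μ ν : Measure X}
    (h : ∀ x, ∃ W : Set X, IsOpen W ∧ x ∈ W ∧ μ.restrict W = ν.restrict W) : μ = ν := by
  simpa using Measure.restrict_eq_of_forall_exists_nhds (S := univ) fun x _ => h x

namespace LocallyPreserves

variable {φ : X → Y} {μ μ' : Measure X} {ν ν' : Measure Y}

theorem eq_of_eq_left [SecondCountableTopology Y] (hφ : IsLocalHomeomorph φ)
    (hsurj : Function.Surjective φ)
    (h : LocallyPreserves φ μ ν) (h' : LocallyPreserves φ μ ν') : ν = ν' := by
  refine Measure.ext_of_forall_exists_nhds fun y => ?_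
  obtain ⟨x, rfl⟩ := hsurj y
  obtain ⟨O, hO, hx, hinj⟩ := hφ.exists_isOpen_injOn x
  exact ⟨φ '' O, hφ.isOpenMap O hO, mem_image_of_mem φ hx, by rw [← h O hO hinj, ← h' O hO hinj]⟩

variable [BorelSpace X] [BorelSpace Y]

theorem apply_image (h : LocallyPreserves φ μ ν) (hφ : IsLocalHomeomorph φ) {O : Set X}
    (hO : IsOpen O) (hinj : InjOn φ O) {E : Set X} (hE : MeasurableSet E) (hEO : E ⊆ O) :
    ν (φ '' E) = μ E := by
  have hm := hφ.measurableSet_image hO hinj hE hEO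
  have := congrArg (fun m => m (φ '' E)) (h O hO hinj)
  rw [Measure.map_apply hφ.continuous.measurable hm,
    Measure.restrict_apply (hφ.continuous.measurable hm), Measure.restrict_apply hm,
    inter_eq_left.mpr (image_mono hEO)] at this
  rw [← this]
  congr 1
  ext z
  constructor
  · rintro ⟨⟨e, he, hez⟩, hz⟩
    rwa [← hinj (hEO he) hz hez]
  · exact fun hz => ⟨mem_image_of_mem φ hz, hEO hz⟩

theorem eq_of_eq_right [SecondCountableTopology X] (hφ : IsLocalHomeomorph φ)
    (h : LocallyPreserves φ μ ν) (h' : LocallyPreserves φ μ' ν) : μ = μ' := by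
  refine Measure.ext_of_forall_exists_nhds fun x => ?_
  obtain ⟨O, hO, hx, hinj⟩ := hφ.exists_isOpen_injOn x
  refine ⟨O, hO, hx, Measure.ext fun E hE => ?_⟩
  rw [Measure.restrict_apply hE, Measure.restrict_apply hE,
    ← h.apply_image hφ hO hinj (hE.inter hO.measurableSet) inter_subset_right,
    ← h'.apply_image hφ hO hinj (hE.inter hO.measurableSet) inter_subset_right]

/-- Locally preserved measures can be pushed forward along a weakly cartesian square. -/
theorem map {X' Y' : Type*} [TopologicalSpace X'] [TopologicalSpace Y'] [MeasurableSpace X']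
    [MeasurableSpace Y'] [BorelSpace X'] [BorelSpace Y'] {φ' : X' → Y'} {a : X → X'} {b : Y → Y'}
    (h : LocallyPreserves φ μ ν) (hφ : Continuous φ) (hφ' : IsLocalHomeomorph φ')
    (ha : Continuous a) (hainj : Function.Injective a) (hb : Continuous b)
    (hcomm : ∀ x, φ' (a x) = b (φ x)) (hcart : ∀ x' y, φ' x' = b y → ∃ x, a x = x' ∧ φ x = y) :
    LocallyPreserves φ' (μ.map a) (ν.map b) := by
  intro V hV hinj
  have hpre : φ '' (a ⁻¹' V) = b ⁻¹' (φ' '' V) := by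
    ext y
    constructor
    · rintro ⟨x, hx, rfl⟩
      exact ⟨a x, hx, hcomm x⟩
    · rintro ⟨x', hx', hy⟩
      obtain ⟨x, rfl, rfl⟩ := hcart x' y hy
      exact ⟨x, hx', rfl⟩
  have hinj' : InjOn φ (a ⁻¹' V) := fun x hx z hz hxz =>
    hainj (hinj hx hz (by rw [hcomm, hcomm, hxz]))
  rw [Measure.restrict_map ha.measurable hV.measurableSet,
    Measure.map_map hφ'.continuous.measurable ha.measurable,
    Measure.restrict_map hb.measurable (hφ'.isOpenMap V hV).measurableSet, ← hpre,
    ← h _ (hV.preimage ha) hinj', Measure.map_map hb.measurable hφ.measurable]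
  congr 1
  exact funext hcomm

theorem exists_lift [SecondCountableTopology X] (hφ : IsLocalHomeomorph φ) (ν : Measure Y) :
    ∃ μ : Measure X, LocallyPreserves φ μ ν := by
  obtain ⟨O, hO, hinj, hcov⟩ := exists_seq_isOpen_cover (p := fun O : Set X => InjOn φ O)
    (injOn_empty φ) fun x => hφ.exists_isOpen_injOn x
  set B := disjointed O with hB
  have hBm : ∀ n, MeasurableSet (B n) := MeasurableSet.disjointed fun n => (hO n).measurableSet
  have hBO : ∀ n, B n ⊆ O n := disjointed_subset O
  have hemb : ∀ n, MeasurableEmbedding ((B n).domRestrict φ) := fun n =>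
    { injective := injOn_iff_injective.mp ((hinj n).mono (hBO n))
      measurable := hφ.continuous.measurable.comp measurable_subtype_coe
      measurableSet_image' := fun s hs => by
        rw [Set.domRestrict_eq, image_comp]
        exact hφ.measurableSet_image (hO n) (hinj n) ((hBm n).subtype_image hs)
          ((Subtype.coe_image_subset _ _).trans (hBO n)) }
  refine ⟨Measure.sum fun n => (ν.comap ((B n).domRestrict φ)).map Subtype.val,
    fun U hU hUinj => Measure.ext fun F hF => ?_⟩
  have hFU := (hφ.continuous.measurable hF).inter hU.measurableSet
  rw [Measure.map_apply hφ.continuous.measurable hF,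
    Measure.restrict_apply (hφ.continuous.measurable hF), Measure.restrict_apply hF,
    Measure.sum_apply _ hFU]
  have hterm : ∀ n, ((ν.comap ((B n).domRestrict φ)).map Subtype.val) (φ ⁻¹' F ∩ U) =
      ν (φ '' (φ ⁻¹' F ∩ U ∩ B n)) := fun n => by
    rw [Measure.map_apply measurable_subtype_coe hFU, (hemb n).comap_apply, Set.domRestrict_eq,
      image_comp, Subtype.image_preimage_coe, inter_comm (B n)]
  simp_rw [hterm]
  rw [← measure_iUnion, ← image_iUnion, ← inter_iUnion, hB, iUnion_disjointed, hcov, inter_univ,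
    inter_comm, image_inter_preimage, inter_comm]
  · intro i j hij
    refine disjoint_image_image fun x hx z hz hxz => ?_
    have := hUinj hx.1.2 hz.1.2 hxz
    subst this
    exact (disjoint_disjointed O hij).le_bot ⟨hx.2, hz.2⟩
  · exact fun n => hφ.measurableSet_image hU hUinj (hFU.inter (hBm n))
      (inter_subset_left.trans inter_subset_right)

theorem exists_descent [SecondCountableTopology Y] (hφ : IsLocalHomeomorph φ)
    (hsurj : Function.Surjective φ) (μ : Measure X)
    (hdeck : ∀ a a', φ a = φ a' → ∃ θ : X → X, Continuous θ ∧ Function.Injective θ ∧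
      (∀ x, φ (θ x) = φ x) ∧ θ a = a' ∧ μ.map θ = μ) :
    ∃ ν : Measure Y, LocallyPreserves φ μ ν := by
  have hφm := hφ.continuous.measurable
  have hclaim : ∀ O O' : Set X, IsOpen O → InjOn φ O → IsOpen O' → InjOn φ O' →
      ((μ.restrict O).map φ).restrict (φ '' O ∩ φ '' O') =
        ((μ.restrict O').map φ).restrict (φ '' O ∩ φ '' O') := by
    intro O O' hO hOi hO' hOi'
    refine Measure.restrict_eq_of_forall_exists_nhds ?_
    rintro _ ⟨⟨a, ha, rfl⟩, a', ha', haa'⟩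
    obtain ⟨θ, hθc, hθi, hθφ, hθa, hθμ⟩ := hdeck a a' haa'.symm
    have hN : IsOpen (O ∩ θ ⁻¹' O') := hO.inter (hO'.preimage hθc)
    refine ⟨φ '' (O ∩ θ ⁻¹' O'), hφ.isOpenMap _ hN,
      mem_image_of_mem φ ⟨ha, by rwa [mem_preimage, hθa]⟩, Measure.ext fun F hF => ?_⟩
    have hFm := hF.inter (hφ.isOpenMap _ hN).measurableSet
    rw [Measure.restrict_apply hF, Measure.restrict_apply hF, Measure.map_apply hφm hFm,
      Measure.map_apply hφm hFm, Measure.restrict_apply (hφm hFm), Measure.restrict_apply (hφm hFm)]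
    nth_rewrite 2 [← hθμ]
    rw [Measure.map_apply hθc.measurable ((hφm hFm).inter hO'.measurableSet)]
    congr 1
    ext z
    simp only [mem_inter_iff, mem_preimage, hθφ]
    constructor
    · rintro ⟨⟨hzF, n, hn, hnz⟩, hzO⟩
      obtain rfl := hOi hn.1 hzO hnz
      exact ⟨⟨hzF, n, hn, rfl⟩, hn.2⟩
    · rintro ⟨⟨hzF, n, hn, hnz⟩, hzO⟩
      obtain rfl := hθi (hOi' hn.2 hzO (by rw [hθφ, hθφ, hnz]))
      exact ⟨⟨hzF, n, hn, rfl⟩, hn.1⟩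
  obtain ⟨W, hW, hWO, hcov⟩ := exists_seq_isOpen_cover
    (p := fun W : Set Y => ∃ O : Set X, IsOpen O ∧ InjOn φ O ∧ φ '' O = W)
    ⟨∅, isOpen_empty, injOn_empty φ, image_empty φ⟩ fun y => by
      obtain ⟨x, rfl⟩ := hsurj y
      obtain ⟨O, hO, hx, hi⟩ := hφ.exists_isOpen_injOn x
      exact ⟨φ '' O, hφ.isOpenMap O hO, mem_image_of_mem φ hx, O, hO, hi, rfl⟩
  choose O hO hOi hOW using hWO
  set D := disjointed W
  have hDm : ∀ n, MeasurableSet (D n) := MeasurableSet.disjointed fun n => (hW n).measurableSet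
  refine ⟨Measure.sum fun n => ((μ.restrict (O n)).map φ).restrict (D n), fun U hU hUi => ?_⟩
  have hUm := (hφ.isOpenMap U hU).measurableSet
  have hself : ((μ.restrict U).map φ).restrict (φ '' U) = (μ.restrict U).map φ := by
    rw [Measure.restrict_map hφm hUm, Measure.restrict_restrict (hφm hUm),
      inter_eq_right.mpr (subset_preimage_image φ U)]
  have hterm : ∀ n, (((μ.restrict (O n)).map φ).restrict (D n)).restrict (φ '' U) =
      (((μ.restrict U).map φ).restrict (D n)).restrict (φ '' U) := fun n => by
    rw [Measure.restrict_restrict hUm, Measure.restrict_restrict hUm]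
    refine Measure.restrict_congr_mono (inter_subset_inter_right _ ?_)
      (hclaim U (O n) hU hUi (hO n) (hOi n)).symm
    rw [hOW]
    exact disjointed_subset W n
  rw [Measure.restrict_sum _ hUm]
  simp_rw [hterm]
  rw [← Measure.restrict_sum _ hUm, ← Measure.restrict_iUnion (disjoint_disjointed W) hDm,
    iUnion_disjointed, hcov, Measure.restrict_univ, hself]

theorem isLocallyFiniteMeasure_left (hφ : IsLocalHomeomorph φ) (h : LocallyPreserves φ μ ν)
    [IsLocallyFiniteMeasure ν] : IsLocallyFiniteMeasure μ := by
  refine ⟨fun x => ?_⟩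
  obtain ⟨O, hO, hx, hi⟩ := hφ.exists_isOpen_injOn x
  obtain ⟨N, hxN, hN, hfin⟩ := ν.exists_isOpen_measure_lt_top (φ x)
  have hON : IsOpen (O ∩ φ ⁻¹' N) := hO.inter (hN.preimage hφ.continuous)
  refine ⟨O ∩ φ ⁻¹' N, hON.mem_nhds ⟨hx, hxN⟩, ?_⟩
  rw [← h.apply_image hφ hO hi hON.measurableSet inter_subset_left]
  exact (measure_mono (image_inter_preimage φ O N ▸ inter_subset_right)).trans_lt hfin

theorem isLocallyFiniteMeasure_right (hφ : IsLocalHomeomorph φ) (hsurj : Function.Surjective φ)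
    (h : LocallyPreserves φ μ ν) [IsLocallyFiniteMeasure μ] : IsLocallyFiniteMeasure ν := by
  refine ⟨fun y => ?_⟩
  obtain ⟨x, rfl⟩ := hsurj y
  obtain ⟨O, hO, hx, hi⟩ := hφ.exists_isOpen_injOn x
  obtain ⟨N, hxN, hN, hfin⟩ := μ.exists_isOpen_measure_lt_top x
  have hON : IsOpen (O ∩ N) := hO.inter hN
  refine ⟨φ '' (O ∩ N), (hφ.isOpenMap _ hON).mem_nhds (mem_image_of_mem φ ⟨hx, hxN⟩), ?_⟩
  rw [h.apply_image hφ hO hi hON.measurableSet inter_subset_left]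
  exact (measure_mono inter_subset_right).trans_lt hfin

theorem mem_support_iff (hφ : IsLocalHomeomorph φ) (h : LocallyPreserves φ μ ν) (x : X) :
    x ∈ μ.support ↔ φ x ∈ ν.support := by
  obtain ⟨O, hO, hx, hi⟩ := hφ.exists_isOpen_injOn x
  simp only [Measure.mem_support_iff_forall]
  constructor
  · intro hμ N hN
    obtain ⟨N', hN'N, hN', hxN'⟩ := mem_nhds_iff.mp hN
    have hON : IsOpen (O ∩ φ ⁻¹' N') := hO.inter (hN'.preimage hφ.continuous)
    refine (hμ _ (hON.mem_nhds ⟨hx, hxN'⟩)).trans_le ?_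
    rw [← h.apply_image hφ hO hi hON.measurableSet inter_subset_left, image_inter_preimage]
    exact measure_mono (inter_subset_right.trans hN'N)
  · intro hν N hN
    obtain ⟨N', hN'N, hN', hxN'⟩ := mem_nhds_iff.mp hN
    have hON : IsOpen (O ∩ N') := hO.inter hN'
    refine (hν _ ((hφ.isOpenMap _ hON).mem_nhds (mem_image_of_mem φ ⟨hx, hxN'⟩))).trans_le ?_
    rw [h.apply_image hφ hO hi hON.measurableSet inter_subset_left]
    exact measure_mono (inter_subset_right.trans hN'N)

end LocallyPreserves

end LocallyPreserves

section LocallyHausdorff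

variable {X Y : Type*} [TopologicalSpace X] [TopologicalSpace Y]

/-- Every point has a Hausdorff open neighbourhood. -/
def IsLocallyT2 (X : Type*) [TopologicalSpace X] : Prop :=
  ∀ x : X, ∃ U : Set X, IsOpen U ∧ x ∈ U ∧ T2Space U

theorem T2Space.mono_set {U V : Set X} (hV : T2Space V) (h : U ⊆ V) : T2Space U :=
  (Topology.IsEmbedding.inclusion h).t2Space

theorem IsLocallyT2.t1Space (h : IsLocallyT2 X) : T1Space X := by
  refine t1Space_iff_exists_open.mpr fun x y hxy => ?_
  obtain ⟨U, hU, hx, hT⟩ := h x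
  by_cases hy : y ∈ U
  · obtain ⟨V, W, hV, -, hxV, hyW, hd⟩ := hT.t2
      (show (⟨x, hx⟩ : U) ≠ ⟨y, hy⟩ from fun h => hxy (congrArg Subtype.val h))
    refine ⟨Subtype.val '' V, hU.isOpenMap_subtype_val V hV, ⟨_, hxV, rfl⟩, ?_⟩
    rintro ⟨z, hz, rfl⟩
    exact hd.le_bot ⟨hz, hyW⟩
  · exact ⟨U, hU, hx, hy⟩

theorem exists_countable_compact_t2_basis_iff :
    (∃ 𝒞 : Set (Set X), 𝒞.Countable ∧ (∀ C ∈ 𝒞, IsCompact C ∧ T2Space C) ∧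
      IsTopologicalBasis (interior '' 𝒞)) ↔
    SecondCountableTopology X ∧ LocallyCompactSpace X ∧ IsLocallyT2 X := by
  constructor
  · rintro ⟨𝒞, hc, hC, hb⟩
    refine ⟨hb.secondCountableTopology (hc.image _), ⟨fun x n hn => ?_⟩, fun x => ?_⟩
    · obtain ⟨_, ⟨C, hC𝒞, rfl⟩, hx, -⟩ := hb.exists_subset_of_mem_open (mem_univ x) isOpen_univ
      obtain ⟨hCc, hCt⟩ := hC C hC𝒞
      have : CompactSpace C := isCompact_iff_compactSpace.mp hCc
      have hmap := map_nhds_subtype_coe_eq_nhds (p := (· ∈ C)) (interior_subset hx)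
        (mem_interior_iff_mem_nhds.mp hx)
      obtain ⟨K, hK, hKn, hKc⟩ := local_compact_nhds (x := (⟨x, interior_subset hx⟩ : C))
        (n := Subtype.val ⁻¹' n) (continuous_subtype_val.continuousAt hn)
      exact ⟨Subtype.val '' K, hmap ▸ Filter.image_mem_map hK, image_subset_iff.mpr hKn,
        hKc.image continuous_subtype_val⟩
    · obtain ⟨_, ⟨C, hC𝒞, rfl⟩, hx, -⟩ := hb.exists_subset_of_mem_open (mem_univ x) isOpen_univ
      exact ⟨interior C, isOpen_interior, hx, (hC C hC𝒞).2.mono_set interior_subset⟩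
  · rintro ⟨_, _, hT⟩
    have hb : IsTopologicalBasis (interior '' {C : Set X | IsCompact C ∧ T2Space C}) := by
      refine isTopologicalBasis_of_isOpen_of_nhds ?_ fun x V hx hV => ?_
      · rintro _ ⟨C, -, rfl⟩
        exact isOpen_interior
      · obtain ⟨U, hU, hxU, hUT⟩ := hT x
        obtain ⟨K, hK, hxK, hKUV⟩ := exists_compact_subset (hU.inter hV) ⟨hxU, hx⟩
        exact ⟨interior K, ⟨K, ⟨hK, hUT.mono_set (hKUV.trans inter_subset_left)⟩, rfl⟩, hxK,
          interior_subset.trans (hKUV.trans inter_subset_right)⟩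
    obtain ⟨B, hBb, hBc, hB⟩ := hb.exists_countable
    choose! c hc using hBb
    refine ⟨c '' B, hBc.image c, ?_, ?_⟩
    · rintro _ ⟨b, hb, rfl⟩
      exact (hc hb).1
    · rw [image_image, image_congr fun b hb => (hc hb).2, image_id']
      exact hB

theorem IsLocalHomeomorph.t2Space_image {φ : X → Y} (hφ : IsLocalHomeomorph φ) {O : Set X}
    (hO : IsOpen O) (hinj : InjOn φ O) [T2Space O] : T2Space (φ '' O) := by
  have h := (hφ.isOpenEmbedding_domRestrict hO hinj).isEmbedding.toHomeomorph.t2Space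
  rwa [range_domRestrict] at h

theorem IsLocalHomeomorph.exists_isOpen_t2_injOn {φ : X → Y} (hφ : IsLocalHomeomorph φ)
    (hX : IsLocallyT2 X) (x : X) :
    ∃ O : Set X, IsOpen O ∧ x ∈ O ∧ T2Space O ∧ InjOn φ O := by
  obtain ⟨O, hO, hx, hi⟩ := hφ.exists_isOpen_injOn x
  obtain ⟨U, hU, hxU, hT⟩ := hX x
  exact ⟨O ∩ U, hO.inter hU, ⟨hx, hxU⟩, hT.mono_set inter_subset_right, hi.mono inter_subset_left⟩

theorem IsLocalHomeomorph.isLocallyT2_left {φ : X → Y} (hφ : IsLocalHomeomorph φ)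
    (hY : IsLocallyT2 Y) : IsLocallyT2 X := by
  intro x
  obtain ⟨O, hO, hx, hi⟩ := hφ.exists_isOpen_injOn x
  obtain ⟨V, hV, hxV, hT⟩ := hY (φ x)
  refine ⟨O ∩ φ ⁻¹' V, hO.inter (hV.preimage hφ.continuous), ⟨hx, hxV⟩, ?_⟩
  refine T2Space.of_injective_continuous (f := fun z : ↥(O ∩ φ ⁻¹' V) => (⟨φ z, z.2.2⟩ : V))
    (fun a b hab => Subtype.ext (hi a.2.1 b.2.1 (congrArg Subtype.val hab)))
    ((hφ.continuous.comp continuous_subtype_val).subtype_mk _)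

theorem IsLocalHomeomorph.isLocallyT2_right {φ : X → Y} (hφ : IsLocalHomeomorph φ)
    (hsurj : Function.Surjective φ) (hX : IsLocallyT2 X) : IsLocallyT2 Y := by
  intro y
  obtain ⟨x, rfl⟩ := hsurj y
  obtain ⟨O, hO, hx, hT, hi⟩ := hφ.exists_isOpen_t2_injOn hX x
  exact ⟨φ '' O, hφ.isOpenMap O hO, mem_image_of_mem φ hx, hφ.t2Space_image hO hi⟩

theorem IsLocalHomeomorph.isOpenQuotientMap {φ : X → Y} (hφ : IsLocalHomeomorph φ)
    (hsurj : Function.Surjective φ) : IsOpenQuotientMap φ :=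
  ⟨hsurj, hφ.continuous, hφ.isOpenMap⟩

theorem IsLocalHomeomorph.locallyCompactSpace_left {φ : X → Y} (hφ : IsLocalHomeomorph φ)
    [LocallyCompactSpace Y] : LocallyCompactSpace X := by
  refine ⟨fun x n hn => ?_⟩
  obtain ⟨O, hO, hx, hi⟩ := hφ.exists_isOpen_injOn x
  have : LocallyCompactSpace O :=
    (hφ.isOpenEmbedding_domRestrict hO hi).locallyCompactSpace
  obtain ⟨K, hK, hKn, hKc⟩ := local_compact_nhds (x := (⟨x, hx⟩ : O))
    (n := Subtype.val ⁻¹' n) (continuous_subtype_val.continuousAt hn)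
  exact ⟨Subtype.val '' K, hO.isOpenMap_subtype_val.image_mem_nhds hK, image_subset_iff.mpr hKn,
    hKc.image continuous_subtype_val⟩

end LocallyHausdorff

section CompactlySupported

variable {X Y : Type*} [TopologicalSpace X] [TopologicalSpace Y]

/-- `f` is continuous on `U` and vanishes outside a compact subset of `U`. -/
def IsCcOn (f : X → ℂ) (U : Set X) : Prop :=
  ContinuousOn f U ∧ ∃ K ⊆ U, IsCompact K ∧ ∀ x ∉ K, f x = 0

theorem mem_ccZero_iff {f : X → ℂ} :
    f ∈ CcZero X ↔ ∃ U : Set X, IsOpen U ∧ T2Space U ∧ IsCcOn f U := by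
  constructor
  · rintro ⟨U, hU, hT, hf0, hfc, hfs⟩
    refine ⟨U, hU, hT, continuousOn_iff_continuous_domRestrict.mpr hfc,
      Subtype.val '' tsupport (fun x : U => f x), Subtype.coe_image_subset _ _,
      hfs.image continuous_subtype_val, fun x hx => ?_⟩
    by_cases hxU : x ∈ U
    · by_contra h
      exact hx ⟨⟨x, hxU⟩, subset_tsupport _ h, rfl⟩
    · exact hf0 x hxU
  · rintro ⟨U, hU, hT, hfc, K, hKU, hK, hf0⟩
    refine ⟨U, hU, hT, fun x hx => hf0 x fun h => hx (hKU h),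
      continuousOn_iff_continuous_domRestrict.mp hfc,
      HasCompactSupport.intro (K := Subtype.val ⁻¹' K) ?_ fun x hx => hf0 x hx⟩
    rw [Subtype.isCompact_iff, Subtype.image_preimage_coe, inter_eq_right.mpr hKU]
    exact hK

theorem IsCcOn.mem_cc {f : X → ℂ} {U : Set X} (hf : IsCcOn f U) (hU : IsOpen U) (hT : T2Space U) :
    f ∈ Cc X :=
  Submodule.subset_span (mem_ccZero_iff.mpr ⟨U, hU, hT, hf⟩)

theorem IsCcOn.comp_isClosedEmbedding {f : Y → ℂ} {U : Set Y} (hf : IsCcOn f U) {ι : X → Y}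
    (hι : Topology.IsClosedEmbedding ι) : IsCcOn (f ∘ ι) (ι ⁻¹' U) := by
  obtain ⟨hc, K, hKU, hK, h0⟩ := hf
  exact ⟨hc.comp hι.continuous.continuousOn (mapsTo_preimage ι U), ι ⁻¹' K, preimage_mono hKU,
    hι.isCompact_preimage hK, fun x hx => h0 _ hx⟩

theorem IsCcOn.continuous_and_hasCompactSupport [T2Space X] {f : X → ℂ} {U : Set X} (hU : IsOpen U)
    (hf : IsCcOn f U) : Continuous f ∧ HasCompactSupport f := by
  obtain ⟨hc, K, hKU, hK, h0⟩ := hf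
  refine ⟨continuous_iff_continuousAt.mpr fun x => ?_, HasCompactSupport.intro hK h0⟩
  by_cases hx : x ∈ U
  · exact hc.continuousAt (hU.mem_nhds hx)
  · refine (continuousAt_const (y := (0 : ℂ))).congr ?_
    filter_upwards [hK.isClosed.isOpen_compl.mem_nhds fun h => hx (hKU h)] with z hz
    exact (h0 z hz).symm

theorem Cc.comp_isClosedEmbedding [T2Space X] {f : Y → ℂ} (hf : f ∈ Cc Y) {ι : X → Y}
    (hι : Topology.IsClosedEmbedding ι) : Continuous (f ∘ ι) ∧ HasCompactSupport (f ∘ ι) := by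
  induction hf using Submodule.span_induction with
  | mem f hf =>
    obtain ⟨U, hU, -, hfU⟩ := mem_ccZero_iff.mp hf
    exact (hfU.comp_isClosedEmbedding hι).continuous_and_hasCompactSupport
      (hU.preimage hι.continuous)
  | zero => exact ⟨continuous_zero, HasCompactSupport.zero⟩
  | add f g _ _ hf hg => exact ⟨hf.1.add hg.1, hf.2.add hg.2⟩
  | smul c f _ hf => exact ⟨hf.1.const_smul c, hf.2.smul_left (f := fun _ => c)⟩

theorem Cc.comp_homeomorph {f : Y → ℂ} (hf : f ∈ Cc Y) (e : X ≃ₜ Y) : f ∘ e ∈ Cc X := by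
  induction hf using Submodule.span_induction with
  | mem f hf =>
    obtain ⟨U, hU, hT, hfU⟩ := mem_ccZero_iff.mp hf
    exact (hfU.comp_isClosedEmbedding e.isClosedEmbedding).mem_cc (hU.preimage e.continuous)
      (e.sets (s := e ⁻¹' U) (t := U) rfl).symm.t2Space
  | zero => exact Submodule.zero_mem _
  | add f g _ _ hf hg => exact Submodule.add_mem _ hf hg
  | smul c f _ hf => exact Submodule.smul_mem _ c hf

theorem Cc.le_span_of_cover [LocallyCompactSpace X] {p : Set X → Prop}
    (hmono : ∀ V W : Set X, p V → IsOpen W → W ⊆ V → p W)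
    (hp : ∀ x, ∃ V : Set X, IsOpen V ∧ x ∈ V ∧ p V) :
    Cc X ≤ Submodule.span ℂ {f | ∃ V : Set X, IsOpen V ∧ T2Space V ∧ p V ∧ IsCcOn f V} := by
  refine Submodule.span_le.mpr fun f hf => ?_
  obtain ⟨U, hU, hT, hfc, K, hKU, hK, h0⟩ := mem_ccZero_iff.mp hf
  have : LocallyCompactSpace U := hU.locallyCompactSpace
  choose V hV hxV hpV using hp
  have hK' : IsCompact (Subtype.val ⁻¹' K : Set U) := by
    rw [Subtype.isCompact_iff, Subtype.image_preimage_coe, inter_eq_right.mpr hKU]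
    exact hK
  obtain ⟨t, ht⟩ := hK'.elim_finite_subcover (fun x : U => (Subtype.val ⁻¹' V x : Set U))
    (fun x => (hV x).preimage continuous_subtype_val) fun x _ => mem_iUnion.mpr ⟨x, hxV x⟩
  obtain ⟨ρ, hρs, hρ1, -, hρc⟩ := exists_continuous_sum_one_of_isOpen_isCompact
    (s := fun i : Fin t.card => (Subtype.val ⁻¹' V (t.equivFin.symm i) : Set U))
    (fun i => (hV _).preimage continuous_subtype_val) hK' fun x hx => by
      obtain ⟨y, hy, hxy⟩ := mem_iUnion₂.mp (ht hx)
      exact mem_iUnion.mpr ⟨t.equivFin ⟨y, hy⟩, by simpa using hxy⟩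
  let g : Fin t.card → X → ℂ := fun i =>
    Function.extend Subtype.val (fun x : U => (ρ i x : ℂ) * f x) 0
  have hgU : ∀ i (x : U), g i x = ρ i x * f x := fun i x =>
    Subtype.val_injective.extend_apply _ _ x
  have hg0 : ∀ i, ∀ x ∉ U, g i x = 0 := fun i x hx =>
    Function.extend_apply' _ _ _ fun ⟨y, hy⟩ => hx (hy ▸ y.2)
  have hsum : f = ∑ i, g i := by
    ext x
    rw [Finset.sum_apply]
    by_cases hx : x ∈ U
    · rw [Finset.sum_congr rfl fun i _ => hgU i ⟨x, hx⟩, ← Finset.sum_mul]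
      by_cases hxK : x ∈ K
      · have h1 := hρ1 (show (⟨x, hx⟩ : U) ∈ Subtype.val ⁻¹' K from hxK)
        rw [Finset.sum_apply, Pi.one_apply] at h1
        rw [← Complex.ofReal_sum, h1, Complex.ofReal_one, one_mul]
      · rw [h0 x hxK, mul_zero]
    · rw [Finset.sum_eq_zero fun i _ => hg0 i x hx, h0 x fun h => hx (hKU h)]
  rw [hsum]
  refine Submodule.sum_mem _ fun i _ => Submodule.subset_span ?_
  have hVU : IsOpen (V (t.equivFin.symm i) ∩ U) := (hV _).inter hU
  refine ⟨V (t.equivFin.symm i) ∩ U, hVU, hT.mono_set inter_subset_right,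
    hmono _ _ (hpV _) hVU inter_subset_left, ?_, Subtype.val '' tsupport (ρ i), ?_,
    (hρc i).image continuous_subtype_val, fun x hx => ?_⟩
  · refine ContinuousOn.mono ?_ inter_subset_right
    rw [continuousOn_iff_continuous_domRestrict] at hfc ⊢
    exact ((Complex.continuous_ofReal.comp (ρ i).continuous).mul hfc).congr fun x => (hgU i x).symm
  · rintro _ ⟨x, hx, rfl⟩
    exact ⟨hρs i hx, x.2⟩
  · by_cases hxU : x ∈ U
    · rw [hgU i ⟨x, hxU⟩, image_eq_zero_of_notMem_tsupport fun h => hx ⟨_, h, rfl⟩,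
        Complex.ofReal_zero, zero_mul]
    · exact hg0 i x hxU

theorem MeasureTheory.Measure.ext_of_integral_ccZero [SecondCountableTopology X]
    [LocallyCompactSpace X] (hX : IsLocallyT2 X) [MeasurableSpace X] [BorelSpace X]
    {μ ν : Measure X} [IsFiniteMeasureOnCompacts μ] [IsFiniteMeasureOnCompacts ν]
    (h : ∀ f ∈ CcZero X, ∫ x, f x ∂μ = ∫ x, f x ∂ν) : μ = ν := by
  refine Measure.ext_of_forall_exists_nhds fun x => ?_
  obtain ⟨U, hU, hx, hT⟩ := hX x
  refine ⟨U, hU, hx, ?_⟩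
  have hemb : MeasurableEmbedding (Subtype.val : U → X) :=
    MeasurableEmbedding.subtype_coe hU.measurableSet
  suffices μ.comap (Subtype.val : U → X) = ν.comap Subtype.val by
    have h' := congrArg (fun m => m.map Subtype.val) this
    simp only [hemb.map_comap, Subtype.range_coe] at h'
    exact h'
  have : LocallyCompactSpace U := hU.locallyCompactSpace
  let _ := metrizableSpaceMetric U
  have hfin : ∀ m : Measure X, IsFiniteMeasureOnCompacts m →
      IsLocallyFiniteMeasure (m.comap (Subtype.val : U → X)) := fun m _ => by
    have : IsFiniteMeasureOnCompacts (m.comap (Subtype.val : U → X)) := ⟨fun K hK => by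
      rw [hemb.comap_apply]
      exact (hK.image continuous_subtype_val).measure_lt_top⟩
    infer_instance
  have := hfin μ inferInstance
  have := hfin ν inferInstance
  refine Measure.ext_of_integral_eq_on_compactlySupported fun f => ?_
  let F : X → ℂ := Function.extend Subtype.val (fun x : U => (f x : ℂ)) 0
  have hFU : ∀ x : U, F x = f x := fun x => Subtype.val_injective.extend_apply _ _ x
  have hF0 : ∀ x ∉ U, F x = 0 := fun x hx =>
    Function.extend_apply' _ _ _ fun ⟨y, hy⟩ => hx (hy ▸ y.2)
  have hF : F ∈ CcZero X := by
    refine ⟨U, hU, hT, hF0, ?_⟩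
    simp only [hFU]
    exact ⟨Complex.continuous_ofReal.comp f.continuous,
      f.hasCompactSupport.comp_left Complex.ofReal_zero⟩
  have hint : ∀ m : Measure X,
      ∫ x, F x ∂m = ((∫ x, f x ∂m.comap Subtype.val : ℝ) : ℂ) := fun m => by
    rw [← integral_complex_ofReal, ← setIntegral_eq_integral_of_forall_compl_eq_zero hF0,
      ← integral_subtype_comap hU.measurableSet]
    simp only [hFU]
  have := h F hF
  rwa [hint, hint, Complex.ofReal_inj] at this

end CompactlySupported

section Groupoid

open Filter Topology

namespace AlgGroupoid

variable {G : Type*} [AlgGroupoid G]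

theorem mul_congr {x x' y y' : G} (hx : x = x') (hy : y = y') (h : dom x = rng y)
    (h' : dom x' = rng y') : mul x y h = mul x' y' h' := by
  subst hx hy
  rfl

theorem rng_mul_eq {u x : G} (hu : dom u = u) (h : u = rng x) :
    mul u x (hu.trans h) = x :=
  (mul_congr h rfl _ (dom_rng x)).trans (rng_mul_self x)

theorem inv_mul_cancel_left (x z : G) (h : dom x = rng z) :
    mul (inv x) (mul x z h) ((dom_inv x).trans (rng_mul x z h).symm) = z := by
  rw [← mul_assoc (inv x) x z (dom_inv x) h,
    mul_congr (inv_mul_self x) rfl _ ((dom_dom x).trans h)]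
  exact rng_mul_eq (dom_dom x) h

theorem mul_inv_cancel_left (x z : G) (h : rng x = rng z) :
    mul x (mul (inv x) z ((dom_inv x).trans h))
      ((rng_inv x).symm.trans (rng_mul _ _ _).symm) = z := by
  rw [← mul_assoc x (inv x) z (rng_inv x).symm,
    mul_congr (mul_inv_self x) rfl _ ((dom_rng x).trans h)]
  exact rng_mul_eq (dom_rng x) h

theorem mul_inv_cancel_right (x z : G) (h : dom x = rng z) :
    mul (mul x z h) (inv z) ((dom_mul x z h).trans (rng_inv z).symm) = x := by
  rw [mul_assoc x z (inv z) h (rng_inv z).symm,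
    mul_congr rfl ((mul_inv_self z).trans h.symm) _ (rng_dom x).symm, mul_dom_self]

theorem inv_mul_cancel_right (x z : G) (h : dom x = dom z) :
    mul (mul x (inv z) (h.trans (rng_inv z).symm)) z ((dom_mul _ _ _).trans (dom_inv z)) = x := by
  rw [mul_assoc x (inv z) z _ (dom_inv z),
    mul_congr rfl ((inv_mul_self z).trans h.symm) _ (rng_dom x).symm, mul_dom_self]

theorem mul_left_cancel {x y z : G} (hy : dom x = rng y) (hz : dom x = rng z)
    (h : mul x y hy = mul x z hz) : y = z := by
  rw [← inv_mul_cancel_left x y hy, ← inv_mul_cancel_left x z hz]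
  exact mul_congr rfl h _ _

instance [TopologicalSpace G] [SecondCountableTopology G] (u : G) :
    SecondCountableTopology (RFiber u) :=
  IsEmbedding.subtypeVal.secondCountableTopology

/-- Left translation by `x`, as a map from the range fibre over `dom x`. -/
def leftMul (x : G) (z : RFiber (dom x)) : G := mul x z.1 z.2.symm

theorem rng_leftMul (x : G) (z : RFiber (dom x)) : rng (leftMul x z) = rng x := rng_mul _ _ _

theorem leftMul_injective (x : G) : Function.Injective (leftMul x) :=
  fun _ _ h => Subtype.ext (mul_left_cancel _ _ h)

variable [TopologicalSpace G] [IsTopGroupoid G]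

theorem continuous_mul_of {T : Type*} [TopologicalSpace T] {f g : T → G} (hf : Continuous f)
    (hg : Continuous g) (h : ∀ t, dom (f t) = rng (g t)) :
    Continuous fun t => mul (f t) (g t) (h t) :=
  (IsTopGroupoid.continuous_mul (G := G)).comp ((hf.prodMk hg).subtype_mk h)

theorem continuous_inv : Continuous (inv : G → G) := IsTopGroupoid.continuous_inv

theorem continuous_rng : Continuous (rng : G → G) :=
  (continuous_mul_of continuous_id continuous_inv fun x => (rng_inv x).symm).congr mul_inv_self

theorem continuous_dom : Continuous (dom : G → G) :=
  (continuous_mul_of continuous_inv continuous_id fun x => dom_inv x).congr inv_mul_self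

/-- Left translation by `x` as a homeomorphism between range fibres. -/
def leftMulHomeomorph (x : G) : RFiber (dom x) ≃ₜ RFiber (rng x) where
  toFun z := ⟨leftMul x z, rng_leftMul x z⟩
  invFun y := ⟨mul (inv x) y.1 ((dom_inv x).trans y.2.symm), (rng_mul _ _ _).trans (rng_inv x)⟩
  left_inv z := Subtype.ext (inv_mul_cancel_left x z.1 z.2.symm)
  right_inv y := Subtype.ext (mul_inv_cancel_left x y.1 y.2.symm)
  continuous_toFun :=
    (continuous_mul_of continuous_const continuous_subtype_val fun z => z.2.symm).subtype_mk _
  continuous_invFun := (continuous_mul_of continuous_const continuous_subtype_val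
    fun y => (dom_inv x).trans y.2.symm).subtype_mk _

theorem isClosedEmbedding_rFiber [T1Space (units G)] (u : units G) :
    IsClosedEmbedding (Subtype.val : RFiber (u : G) → G) := by
  suffices IsClosed {x : G | rng x = u} from this.isClosedEmbedding_subtypeVal
  have h : Continuous fun x : G => (⟨rng x, rng_mem_units x⟩ : units G) :=
    continuous_rng.subtype_mk _
  have heq : (fun x : G => (⟨rng x, rng_mem_units x⟩ : units G)) ⁻¹' {u} =
      {x : G | rng x = u} := ext fun x => Subtype.ext_iff
  exact heq ▸ (isClosed_singleton (x := u)).preimage h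

theorem locallyCompactSpace_rFiber [T1Space (units G)] [LocallyCompactSpace G] (u : units G) :
    LocallyCompactSpace (RFiber (u : G)) :=
  (isClosedEmbedding_rFiber u).locallyCompactSpace

theorem isClosedEmbedding_leftMul [T1Space (units G)] (x : G) :
    IsClosedEmbedding (leftMul x) :=
  (isClosedEmbedding_rFiber ⟨rng x, rng_mem_units x⟩).comp
    (leftMulHomeomorph x).isClosedEmbedding

theorem t2Space_rFiber [T1Space G] [T2Space (units G)] (u : units G) :
    T2Space (RFiber (u : G)) := by
  refine t2_iff_nhds.mpr fun {x y} hne => ?_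
  have hdomc : Continuous fun z : RFiber (u : G) => (⟨dom z.1, dom_mem_units z.1⟩ : units G) :=
    (continuous_dom.comp continuous_subtype_val).subtype_mk _
  have hdom : dom y.1 = dom x.1 := congrArg Subtype.val
    (tendsto_nhds_unique (hdomc.continuousAt.mono_left (inf_le_right (a := 𝓝 x)))
      (hdomc.continuousAt.mono_left (inf_le_left (b := 𝓝 y))))
  let g : G := mul y.1 (inv x.1) (hdom.trans (rng_inv _).symm)
  have hgdom : dom g = u := (dom_mul _ _ _).trans ((dom_inv _).trans x.2)
  have hgx : mul g x.1 (hgdom.trans x.2.symm) = y.1 := inv_mul_cancel_right y.1 x.1 hdom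
  have h1 : Tendsto (fun z : RFiber (u : G) => mul g z.1 (hgdom.trans z.2.symm)) (𝓝 x ⊓ 𝓝 y)
      (𝓝 y.1) := by
    rw [← hgx]
    exact (continuous_mul_of continuous_const continuous_subtype_val
      fun z : RFiber (u : G) => hgdom.trans z.2.symm).continuousAt.mono_left inf_le_left
  have h2 : Tendsto (fun z : RFiber (u : G) => inv z.1) (𝓝 x ⊓ 𝓝 y) (𝓝 (inv y.1)) :=
    (continuous_inv.comp continuous_subtype_val).continuousAt.mono_left inf_le_right
  have hcomp : ∀ z : RFiber (u : G), dom (mul g z.1 (hgdom.trans z.2.symm)) = rng (inv z.1) :=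
    fun z => (dom_mul _ _ _).trans (rng_inv _).symm
  have h3 : Tendsto (fun z : RFiber (u : G) =>
      (⟨(mul g z.1 (hgdom.trans z.2.symm), inv z.1), hcomp z⟩ :
        {p : G × G // dom p.1 = rng p.2})) (𝓝 x ⊓ 𝓝 y)
      (𝓝 ⟨(y.1, inv y.1), (rng_inv y.1).symm⟩) :=
    tendsto_subtype_rng.mpr (h1.prodMk_nhds h2)
  have h4 := ((IsTopGroupoid.continuous_mul (G := G)).tendsto _).comp h3
  have h5 : Tendsto (fun _ : RFiber (u : G) => g) (𝓝 x ⊓ 𝓝 y) (𝓝 (rng y.1)) := by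
    rw [← mul_inv_self y.1]
    exact h4.congr fun z => mul_inv_cancel_right g z.1 (hgdom.trans z.2.symm)
  have h6 : g = rng y.1 := tendsto_const_nhds_iff.mp h5
  refine Subtype.ext ?_
  rw [← hgx, mul_congr h6 rfl _ ((dom_rng _).trans (y.2.trans x.2.symm))]
  exact (rng_mul_eq (dom_rng _) (y.2.trans x.2.symm)).symm

end AlgGroupoid

section Measure

theorem map_mul_eq_of_left_invariant
    {G : Type*} [AlgGroupoid G] [MeasurableSpace G]
    {lam : ∀ u : units G, Measure (RFiber (u : G))}
    (hinv : ∀ x : G, (lam ⟨dom x, dom_mem_units x⟩).map (leftMul x) =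
      (lam ⟨rng x, rng_mem_units x⟩).map Subtype.val)
    {u : units G} {g : G} (hd : dom g = u) (hr : rng g = u) :
    (lam u).map (fun z => mul g z.1 (hd.trans z.2.symm)) = (lam u).map Subtype.val := by
  obtain ⟨w, hw⟩ := u
  obtain rfl : dom g = w := hd
  have h : (⟨rng g, rng_mem_units g⟩ : units G) = ⟨dom g, hw⟩ := Subtype.ext hr
  refine (hinv g).trans ?_
  rw [h]

variable {G : Type*} [AlgGroupoid G] [TopologicalSpace G] [IsTopGroupoid G] [MeasurableSpace G]
  [BorelSpace G] {lam : ∀ u : units G, Measure (RFiber (u : G))}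

theorem isFiniteMeasureOnCompacts_map {X Y : Type*} [TopologicalSpace X] [TopologicalSpace Y]
    [MeasurableSpace X] [MeasurableSpace Y] [BorelSpace X] [BorelSpace Y] {ι : X → Y}
    (hι : IsClosedEmbedding ι) (μ : Measure X) [IsFiniteMeasureOnCompacts μ] :
    IsFiniteMeasureOnCompacts (μ.map ι) := ⟨fun K hK => by
  rw [hι.measurableEmbedding.map_apply]
  exact (hι.isCompact_preimage hK).measure_lt_top⟩

/-- The integral form of left invariance amounts to an equality of measures on the groupoid. -/
theorem left_invariant_iff [T2Space (units G)] [SecondCountableTopology G] [LocallyCompactSpace G]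
    (hG : IsLocallyT2 G) (hfin : ∀ u, IsFiniteMeasureOnCompacts (lam u)) :
    (∀ (x : G), ∀ f ∈ Cc G,
      ∫ z, f (mul x z.1 z.2.symm) ∂(lam ⟨dom x, dom_mem_units x⟩) =
        ∫ y, f y.1 ∂(lam ⟨rng x, rng_mem_units x⟩)) ↔
    ∀ x : G, (lam ⟨dom x, dom_mem_units x⟩).map (leftMul x) =
      (lam ⟨rng x, rng_mem_units x⟩).map Subtype.val := by
  have hL : ∀ (x : G) (f : G → ℂ), ∫ z, f z ∂(lam ⟨dom x, dom_mem_units x⟩).map (leftMul x) =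
      ∫ z, f (mul x z.1 z.2.symm) ∂(lam ⟨dom x, dom_mem_units x⟩) := fun x f =>
    (isClosedEmbedding_leftMul x).measurableEmbedding.integral_map f
  have hV : ∀ (u : units G) (f : G → ℂ), ∫ z, f z ∂(lam u).map Subtype.val =
      ∫ z, f z.1 ∂(lam u) := fun u f =>
    (isClosedEmbedding_rFiber u).measurableEmbedding.integral_map f
  constructor
  · intro h x
    have := isFiniteMeasureOnCompacts_map (isClosedEmbedding_leftMul x)
      (lam ⟨dom x, dom_mem_units x⟩)
    have := isFiniteMeasureOnCompacts_map (isClosedEmbedding_rFiber ⟨rng x, rng_mem_units x⟩)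
      (lam ⟨rng x, rng_mem_units x⟩)
    refine Measure.ext_of_integral_ccZero hG fun f hf => ?_
    rw [hL, hV]
    exact h x f (Submodule.subset_span hf)
  · intro h x f _
    rw [← hL, ← hV, h x]

theorem Cc.integrable_rFiber [T2Space (units G)] [T1Space G]
    (hfin : ∀ u, IsFiniteMeasureOnCompacts (lam u)) {f : G → ℂ} (hf : f ∈ Cc G) (u : units G) :
    Integrable (fun z : RFiber (u : G) => f z.1) (lam u) := by
  have := t2Space_rFiber u
  obtain ⟨hc, hs⟩ := Cc.comp_isClosedEmbedding hf (isClosedEmbedding_rFiber u)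
  exact hc.integrable_of_hasCompactSupport hs

theorem integral_mem_cc_of_span [T2Space (units G)] [T1Space G]
    (hfin : ∀ u, IsFiniteMeasureOnCompacts (lam u)) {S : Set (G → ℂ)} (hS : S ⊆ Cc G)
    (hspan : Cc G ≤ Submodule.span ℂ S)
    (h : ∀ g ∈ S, (fun u : units G => ∫ z, g z.1 ∂(lam u)) ∈ Cc (units G)) (g : G → ℂ)
    (hg : g ∈ Cc G) : (fun u : units G => ∫ z, g z.1 ∂(lam u)) ∈ Cc (units G) := by
  have hle := Submodule.span_le.mpr hS
  replace hg := hspan hg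
  induction hg using Submodule.span_induction with
  | mem g hg => exact h g hg
  | zero =>
    simp only [Pi.zero_apply, integral_zero]
    exact Submodule.zero_mem _
  | add f g hf hg hf' hg' =>
    simp only [Pi.add_apply]
    rw [funext fun u => integral_add (Cc.integrable_rFiber hfin (hle hf) u)
      (Cc.integrable_rFiber hfin (hle hg) u)]
    exact Submodule.add_mem _ hf' hg'
  | smul c f hf hf' =>
    simp only [Pi.smul_apply]
    rw [funext fun u => integral_smul c _]
    exact Submodule.smul_mem _ c hf'

end Measure

end Groupoid

section Covering

variable {G H : Type*} [AlgGroupoid G] [AlgGroupoid H] {π : G → H}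

/-- The map `G^u → H^v` induced by a homomorphism `π` with `π u = v`. -/
def IsGroupoidHom.fiberMap (hπ : IsGroupoidHom π) {u : G} {v : H} (h : π u = v)
    (x : RFiber u) : RFiber v :=
  ⟨π x.1, by rw [← hπ.map_rng, x.2, h]⟩

/-- On every pair of corresponding range fibres, `lamG` is locally preserved onto `lamH`. -/
def FiberwisePreserves [TopologicalSpace G] [MeasurableSpace G] [MeasurableSpace H]
    (hπ : IsGroupoidHom π) (lamG : ∀ u : units G, Measure (RFiber (u : G)))
    (lamH : ∀ v : units H, Measure (RFiber (v : H))) : Prop :=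
  ∀ (u : units G) (v : units H) (h : π u = v),
    LocallyPreserves (hπ.fiberMap h) (lamG u) (lamH v)

variable [TopologicalSpace G] [TopologicalSpace H]

namespace IsFiberwiseGroupoidCovering

variable (hπ : IsFiberwiseGroupoidCovering π)
include hπ

theorem units_injective {u u' : G} (hu : dom u = u) (hu' : dom u' = u') (h : π u = π u') :
    u = u' :=
  congrArg Subtype.val (hπ.units_homeo.injective (a₁ := ⟨u, hu⟩) (a₂ := ⟨u', hu'⟩)
    (Subtype.ext h))

theorem rng_eq {x y : G} (h : rng (π x) = rng (π y)) : rng x = rng y :=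
  hπ.units_injective (dom_rng x) (dom_rng y) (by rw [hπ.hom.map_rng, hπ.hom.map_rng, h])

theorem dom_eq {x y : G} (h : dom (π x) = dom (π y)) : dom x = dom y :=
  hπ.units_injective (dom_dom x) (dom_dom y) (by rw [hπ.hom.map_dom, hπ.hom.map_dom, h])

theorem exists_rFiber_eq {u : units G} {v : units H} (h : π u = v) {x : G} (hx : rng (π x) = v) :
    ∃ z : RFiber (u : G), z.1 = x :=
  ⟨⟨x, hπ.units_injective (dom_rng x) u.2 (by rw [hπ.hom.map_rng, hx, h])⟩, rfl⟩

theorem fiberMap_image_preimage {u : units G} {v : units H} (h : π u = v) (V : Set G) :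
    hπ.hom.fiberMap h '' (Subtype.val ⁻¹' V) = Subtype.val ⁻¹' (π '' V) := by
  ext y
  constructor
  · rintro ⟨x, hx, rfl⟩
    exact ⟨x.1, hx, rfl⟩
  · rintro ⟨x, hx, hxy⟩
    obtain ⟨z, rfl⟩ := hπ.exists_rFiber_eq h (x := x) (by rw [hxy, y.2])
    exact ⟨z, hx, Subtype.ext hxy⟩

omit [TopologicalSpace G] [TopologicalSpace H] hπ in
theorem injOn_fiberMap (hom : IsGroupoidHom π) {u : G} {v : H} (h : π u = v) {V : Set G}
    (hV : InjOn π V) : InjOn (hom.fiberMap h) (Subtype.val ⁻¹' V) :=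
  fun _ hx _ hz hxz => Subtype.ext (hV hx hz (congrArg Subtype.val hxz))

theorem fiberMap_surjective {u : units G} {v : units H} (h : π u = v) :
    Function.Surjective (hπ.hom.fiberMap h) := by
  intro y
  obtain ⟨x, hx⟩ := hπ.surjective y.1
  obtain ⟨z, rfl⟩ := hπ.exists_rFiber_eq h (x := x) (by rw [hx, y.2])
  exact ⟨z, Subtype.ext hx⟩

theorem fiberMap_isLocalHomeomorph {u : units G} {v : units H} (h : π u = v) :
    IsLocalHomeomorph (hπ.hom.fiberMap h) := by
  have hcont : Continuous (hπ.hom.fiberMap h) :=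
    (hπ.isLocalHomeomorph.continuous.comp continuous_subtype_val).subtype_mk _
  have hopen : IsOpenMap (hπ.hom.fiberMap h) := by
    rintro _ ⟨V, hV, rfl⟩
    rw [hπ.fiberMap_image_preimage h]
    exact (hπ.isLocalHomeomorph.isOpenMap V hV).preimage continuous_subtype_val
  refine isLocalHomeomorph_iff_isOpenEmbedding_restrict.mpr fun x => ?_
  obtain ⟨O, hO, hx, hi⟩ := hπ.isLocalHomeomorph.exists_isOpen_injOn x.1
  have hO' := hO.preimage (continuous_subtype_val (p := fun z : G => rng z = u))
  exact ⟨_, hO'.mem_nhds hx, .of_continuous_injective_isOpenMap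
    (hcont.comp continuous_subtype_val) (injOn_iff_injective.mp (injOn_fiberMap hπ.hom h hi))
    (hopen.comp hO'.isOpenMap_subtype_val)⟩

/-- The homeomorphism of the unit spaces. -/
def unitsHomeomorph : units G ≃ₜ units H := hπ.units_homeo.homeomorph

theorem unitsHomeomorph_apply (u : units G) : (hπ.unitsHomeomorph u : H) = π u := rfl

theorem unitsHomeomorph_symm_apply (v : units H) : π (hπ.unitsHomeomorph.symm v) = v :=
  congrArg Subtype.val (hπ.unitsHomeomorph.apply_symm_apply v)

end IsFiberwiseGroupoidCovering

end Covering

section Functions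

variable {X Y : Type*} [TopologicalSpace X] [TopologicalSpace Y] {φ : X → Y}

theorem IsCcOn.indicator_comp (hφ : IsLocalHomeomorph φ) {V : Set X} (hV : IsOpen V)
    (hi : InjOn φ V) {h : Y → ℂ} (hh : IsCcOn h (φ '' V)) :
    IsCcOn (V.indicator (h ∘ φ)) V := by
  obtain ⟨hc, K, hKV, hK, h0⟩ := hh
  have hemb := hφ.isOpenEmbedding_domRestrict hV hi
  refine ⟨((hc.comp hφ.continuous.continuousOn (mapsTo_image φ V))).congr
    fun x hx => indicator_of_mem hx _, Subtype.val '' (V.domRestrict φ ⁻¹' K),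
    Subtype.coe_image_subset _ _, ?_, fun x hx => ?_⟩
  · refine IsCompact.image ?_ continuous_subtype_val
    refine hemb.isInducing.isCompact_preimage' hK ?_
    rwa [range_domRestrict]
  · by_cases hxV : x ∈ V
    · rw [indicator_of_mem hxV]
      exact h0 _ fun hxK => hx ⟨⟨x, hxV⟩, hxK, rfl⟩
    · exact indicator_of_notMem hxV _

theorem IsCcOn.exists_descent (hφ : IsLocalHomeomorph φ) {V : Set X} (hV : IsOpen V)
    (hi : InjOn φ V) {g : X → ℂ} (hg : IsCcOn g V) :
    ∃ h : Y → ℂ, IsCcOn h (φ '' V) ∧ ∀ x ∈ V, h (φ x) = g x := by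
  obtain ⟨hc, K, hKV, hK, h0⟩ := hg
  have hemb := hφ.isOpenEmbedding_domRestrict hV hi
  let h : Y → ℂ := Function.extend (V.domRestrict φ) (V.domRestrict g) 0
  have hh : ∀ x : V, h (φ x) = g x := fun x => hemb.injective.extend_apply _ _ x
  refine ⟨h, ⟨?_, φ '' K, image_mono hKV, hK.image hφ.continuous, fun y hy => ?_⟩,
    fun x hx => hh ⟨x, hx⟩⟩
  · rintro _ ⟨x, hx, rfl⟩
    refine ContinuousAt.continuousWithinAt ?_
    refine (hemb.continuousAt_iff (x := ⟨x, hx⟩)).mp ?_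
    exact (continuousOn_iff_continuous_domRestrict.mp hc).continuousAt.congr
      (Filter.Eventually.of_forall fun z => (hh z).symm)
  · by_cases hyV : y ∈ φ '' V
    · obtain ⟨x, hx, rfl⟩ := hyV
      rw [hh ⟨x, hx⟩]
      exact h0 x fun hxK => hy (mem_image_of_mem φ hxK)
    · exact Function.extend_apply' _ _ _ fun ⟨z, hz⟩ => hyV ⟨z, z.2, hz⟩

end Functions

section Transfer

variable {G H : Type*} [AlgGroupoid G] [AlgGroupoid H] [TopologicalSpace G] [TopologicalSpace H]
  [MeasurableSpace G] [MeasurableSpace H] {π : G → H}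
  {lamG : ∀ u : units G, Measure (RFiber (u : G))} {lamH : ∀ v : units H, Measure (RFiber (v : H))}

theorem FiberwisePreserves.intertwinesHaar (hπ : IsFiberwiseGroupoidCovering π)
    (h : FiberwisePreserves hπ.hom lamG lamH) : IntertwinesHaar hπ.hom lamG lamH := by
  intro u U hU hemb
  rw [← hπ.fiberMap_image_preimage rfl U]
  exact h u (hπ.hom.onUnits u) rfl _ (hU.preimage continuous_subtype_val)
    (IsFiberwiseGroupoidCovering.injOn_fiberMap _ _ (injOn_iff_injective.mpr hemb.injective))

variable [BorelSpace G] [BorelSpace H]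

theorem FiberwisePreserves.map_val (hπ : IsFiberwiseGroupoidCovering π)
    (hp : FiberwisePreserves hπ.hom lamG lamH) (u : units G) (v : units H) (h : π u = v) :
    LocallyPreserves π ((lamG u).map Subtype.val) ((lamH v).map Subtype.val) := by
  refine (hp u v h).map (hπ.fiberMap_isLocalHomeomorph h).continuous hπ.isLocalHomeomorph
    continuous_subtype_val Subtype.val_injective continuous_subtype_val (fun _ => rfl)
    fun x y hxy => ?_
  obtain ⟨z, rfl⟩ := hπ.exists_rFiber_eq h (x := x) (by rw [hxy, y.2])
  exact ⟨z, rfl, Subtype.ext hxy⟩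

theorem FiberwisePreserves.integral_eq [IsTopGroupoid H] [T1Space H] [T2Space (units H)]
    (hπ : IsFiberwiseGroupoidCovering π)
    (hp : FiberwisePreserves hπ.hom lamG lamH) {V : Set G} (hV : IsOpen V) (hi : InjOn π V)
    {g : G → ℂ} {h : H → ℂ} (hh : h ∈ Cc H) (hg0 : ∀ x ∉ V, g x = 0) (hh0 : ∀ y ∉ π '' V, h y = 0)
    (hgh : ∀ x ∈ V, h (π x) = g x) {u : units G} {v : units H} (huv : π u = v) :
    ∫ z, g z.1 ∂(lamG u) = ∫ y, h y.1 ∂(lamH v) := by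
  have hloc := hπ.fiberMap_isLocalHomeomorph huv
  have hVu := hV.preimage (continuous_subtype_val (p := fun z : G => rng z = u))
  have := t2Space_rFiber v
  have hc := (Cc.comp_isClosedEmbedding hh (isClosedEmbedding_rFiber v)).1
  calc ∫ z, g z.1 ∂(lamG u)
      = ∫ z in Subtype.val ⁻¹' V, g z.1 ∂(lamG u) :=
        (setIntegral_eq_integral_of_forall_compl_eq_zero
          (f := fun z : RFiber (u : G) => g z.1) fun z hz => hg0 _ hz).symm
    _ = ∫ z in Subtype.val ⁻¹' V, h (hπ.hom.fiberMap huv z).1 ∂(lamG u) :=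
        setIntegral_congr_fun hVu.measurableSet fun z hz => (hgh _ hz).symm
    _ = ∫ y in Subtype.val ⁻¹' (π '' V), h y.1 ∂(lamH v) := by
        rw [← hπ.fiberMap_image_preimage huv V, ← hp u v huv _ hVu
          (IsFiberwiseGroupoidCovering.injOn_fiberMap _ _ hi)]
        exact (integral_map hloc.continuous.measurable.aemeasurable
          hc.aestronglyMeasurable).symm
    _ = ∫ y, h y.1 ∂(lamH v) :=
        setIntegral_eq_integral_of_forall_compl_eq_zero
          (f := fun y : RFiber (v : H) => h y.1) fun y hy => hh0 _ hy

end Transfer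

section HaarTransfer

variable {G H : Type*} [AlgGroupoid G] [AlgGroupoid H] [TopologicalSpace G] [TopologicalSpace H]
  [MeasurableSpace G] [MeasurableSpace H] [BorelSpace G] [BorelSpace H] [IsTopGroupoid G]
  [IsTopGroupoid H] {π : G → H}
  {lamG : ∀ u : units G, Measure (RFiber (u : G))} {lamH : ∀ v : units H, Measure (RFiber (v : H))}

theorem regular_of_isLocallyFiniteMeasure {X : Type*} [TopologicalSpace X] [T2Space X]
    [LocallyCompactSpace X] [SecondCountableTopology X] [MeasurableSpace X] [BorelSpace X]
    (μ : Measure X) [IsLocallyFiniteMeasure μ] : μ.Regular := by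
  let _ := metrizableSpaceMetric X
  infer_instance

section

variable (hπ : IsFiberwiseGroupoidCovering π) (hp : FiberwisePreserves hπ.hom lamG lamH)
include hp

theorem FiberwisePreserves.map_leftMul (x : G) :
    LocallyPreserves π ((lamG ⟨dom x, dom_mem_units x⟩).map (leftMul x))
      ((lamH ⟨dom (π x), dom_mem_units (π x)⟩).map (leftMul (π x))) := by
  have h : π (dom x) = dom (π x) := hπ.hom.map_dom x
  have hcomm : ∀ z, π (leftMul x z) = leftMul (π x) (hπ.hom.fiberMap h z) := fun z =>
    hπ.hom.map_mul x z.1 z.2.symm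
  refine (hp ⟨dom x, dom_mem_units x⟩ ⟨dom (π x), dom_mem_units (π x)⟩ h).map
    (hπ.fiberMap_isLocalHomeomorph (u := ⟨dom x, dom_mem_units x⟩)
      (v := ⟨dom (π x), dom_mem_units (π x)⟩) h).continuous hπ.isLocalHomeomorph
    (continuous_mul_of continuous_const continuous_subtype_val fun z => z.2.symm)
    (leftMul_injective x)
    (continuous_mul_of continuous_const continuous_subtype_val fun z => z.2.symm) hcomm
    fun x' y hxy => ?_
  have hr : rng x = rng x' := hπ.rng_eq (by rw [hxy, rng_leftMul])
  let z : RFiber (dom x) :=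
    ⟨mul (inv x) x' ((dom_inv x).trans hr), (rng_mul _ _ _).trans (rng_inv x)⟩
  have hz : leftMul x z = x' := mul_inv_cancel_left x x' hr
  exact ⟨z, hz, leftMul_injective (π x) (by rw [← hcomm, hz, hxy])⟩

variable [T2Space (units G)] [T2Space (units H)] [SecondCountableTopology G]
  [SecondCountableTopology H] [LocallyCompactSpace G] [LocallyCompactSpace H]

theorem FiberwisePreserves.isHaarSystem_left (hG : IsLocallyT2 G) (hH : IsLocallyT2 H)
    (hlam : IsHaarSystem lamH) : IsHaarSystem lamG := by
  have := hG.t1Space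
  have := hH.t1Space
  have hv : ∀ u : units G, ∃ v : units H, π u = v := fun u => ⟨hπ.unitsHomeomorph u, rfl⟩
  have hreg : ∀ u, (lamG u).Regular := fun u => by
    obtain ⟨v, h⟩ := hv u
    have := hlam.regular v
    have := t2Space_rFiber u
    have := locallyCompactSpace_rFiber u
    have := locallyCompactSpace_rFiber v
    have := (hp u v h).isLocallyFiniteMeasure_left (hπ.fiberMap_isLocalHomeomorph h)
    exact regular_of_isLocallyFiniteMeasure _
  have hfinG : ∀ u, IsFiniteMeasureOnCompacts (lamG u) := fun u => (hreg u).1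
  have hfinH : ∀ v, IsFiniteMeasureOnCompacts (lamH v) := fun v => (hlam.regular v).1
  refine ⟨hreg, fun u => eq_univ_of_forall fun x => ?_, ?_, ?_⟩
  · obtain ⟨v, h⟩ := hv u
    rw [(hp u v h).mem_support_iff (hπ.fiberMap_isLocalHomeomorph h), hlam.full_support]
    trivial
  · refine integral_mem_cc_of_span hfinG ?_ (Cc.le_span_of_cover (p := fun V : Set G => InjOn π V)
      (fun V W hV _ hWV => hV.mono hWV) hπ.isLocalHomeomorph.exists_isOpen_injOn) ?_
    · rintro g ⟨V, hV, hT, -, hg⟩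
      exact hg.mem_cc hV hT
    · rintro g ⟨V, hV, hT, hi, hg⟩
      obtain ⟨h, hh, hgh⟩ := hg.exists_descent hπ.isLocalHomeomorph hV hi
      have hhc := hh.mem_cc (hπ.isLocalHomeomorph.isOpenMap V hV)
        (hπ.isLocalHomeomorph.t2Space_image hV hi)
      obtain ⟨-, K, hKV, -, hg0⟩ := hg
      obtain ⟨-, K', hKV', -, hh0⟩ := hh
      rw [funext fun u => hp.integral_eq hπ hV hi hhc (fun x hx => hg0 x fun h => hx (hKV h))
        (fun y hy => hh0 y fun h => hy (hKV' h)) hgh (hπ.unitsHomeomorph_apply u).symm]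
      exact Cc.comp_homeomorph (hlam.continuous h hhc) hπ.unitsHomeomorph
  · refine (left_invariant_iff hG hfinG).mpr fun x => ?_
    have hinv := (left_invariant_iff hH hfinH).mp hlam.left_invariant (π x)
    refine LocallyPreserves.eq_of_eq_right hπ.isLocalHomeomorph (hp.map_leftMul hπ x) ?_
    rw [hinv]
    exact hp.map_val hπ _ _ (hπ.hom.map_rng x)

theorem FiberwisePreserves.isHaarSystem_right (hG : IsLocallyT2 G) (hH : IsLocallyT2 H)
    (hlam : IsHaarSystem lamG) : IsHaarSystem lamH := by
  have := hG.t1Space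
  have := hH.t1Space
  have hu : ∀ v : units H, ∃ u : units G, π u = v := fun v =>
    ⟨hπ.unitsHomeomorph.symm v, hπ.unitsHomeomorph_symm_apply v⟩
  have hreg : ∀ v, (lamH v).Regular := fun v => by
    obtain ⟨u, h⟩ := hu v
    have := hlam.regular u
    have := t2Space_rFiber v
    have := locallyCompactSpace_rFiber u
    have := locallyCompactSpace_rFiber v
    have := (hp u v h).isLocallyFiniteMeasure_right (hπ.fiberMap_isLocalHomeomorph h)
      (hπ.fiberMap_surjective h)
    exact regular_of_isLocallyFiniteMeasure _
  have hfinG : ∀ u, IsFiniteMeasureOnCompacts (lamG u) := fun u => (hlam.regular u).1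
  have hfinH : ∀ v, IsFiniteMeasureOnCompacts (lamH v) := fun v => (hreg v).1
  refine ⟨hreg, fun v => eq_univ_of_forall fun y => ?_, ?_, ?_⟩
  · obtain ⟨u, h⟩ := hu v
    obtain ⟨x, rfl⟩ := hπ.fiberMap_surjective h y
    rw [← (hp u v h).mem_support_iff (hπ.fiberMap_isLocalHomeomorph h), hlam.full_support]
    trivial
  · refine integral_mem_cc_of_span hfinH ?_ (Cc.le_span_of_cover
      (p := fun W : Set H => ∃ V : Set G, IsOpen V ∧ T2Space V ∧ InjOn π V ∧ π '' V = W) ?_ ?_) ?_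
    · rintro h ⟨W, hW, hT, -, hh⟩
      exact hh.mem_cc hW hT
    · rintro _ W ⟨V, hV, hT, hi, rfl⟩ hW hWV
      exact ⟨V ∩ π ⁻¹' W, hV.inter (hW.preimage hπ.isLocalHomeomorph.continuous),
        hT.mono_set inter_subset_left, hi.mono inter_subset_left,
        by rw [image_inter_preimage, inter_eq_right.mpr hWV]⟩
    · intro y
      obtain ⟨x, rfl⟩ := hπ.surjective y
      obtain ⟨V, hV, hx, hT, hi⟩ := hπ.isLocalHomeomorph.exists_isOpen_t2_injOn hG x
      exact ⟨π '' V, hπ.isLocalHomeomorph.isOpenMap V hV, mem_image_of_mem π hx, V, hV, hT, hi, rfl⟩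
    · rintro h ⟨_, hW, hWT, ⟨V, hV, hT, hi, rfl⟩, hh⟩
      have hgc := (hh.indicator_comp hπ.isLocalHomeomorph hV hi).mem_cc hV hT
      have hhc := hh.mem_cc hW hWT
      obtain ⟨-, K', hKV', -, hh0⟩ := hh
      rw [funext fun v => (hp.integral_eq hπ hV hi hhc (g := V.indicator (h ∘ π))
        (fun x hx => indicator_of_notMem hx _) (fun y hy => hh0 y fun h => hy (hKV' h))
        (fun x hx => (indicator_of_mem hx (h ∘ π)).symm) (hπ.unitsHomeomorph_symm_apply v)).symm]
      exact Cc.comp_homeomorph (hlam.continuous _ hgc) hπ.unitsHomeomorph.symm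
  · refine (left_invariant_iff hH hfinH).mpr fun y => ?_
    obtain ⟨x, rfl⟩ := hπ.surjective y
    have hinv := (left_invariant_iff hG hfinG).mp hlam.left_invariant x
    refine LocallyPreserves.eq_of_eq_left hπ.isLocalHomeomorph hπ.surjective
      (hp.map_leftMul hπ x) ?_
    rw [hinv]
    exact hp.map_val hπ _ _ (hπ.hom.map_rng x)

end

omit [IsTopGroupoid G] [IsTopGroupoid H] in
theorem IsFiberwiseGroupoidCovering.exists_fiberwisePreserves_left
    (hπ : IsFiberwiseGroupoidCovering π) [SecondCountableTopology G]
    (lamH : ∀ v : units H, Measure (RFiber (v : H))) :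
    ∃ lamG : ∀ u : units G, Measure (RFiber (u : G)), FiberwisePreserves hπ.hom lamG lamH := by
  have h := fun u : units G => LocallyPreserves.exists_lift
    (hπ.fiberMap_isLocalHomeomorph (hπ.unitsHomeomorph_apply u).symm) (lamH (hπ.unitsHomeomorph u))
  choose lamG hlam using h
  refine ⟨lamG, fun u v h => ?_⟩
  obtain rfl : hπ.unitsHomeomorph u = v := Subtype.ext h
  exact hlam u

omit [MeasurableSpace H] [BorelSpace H] [IsTopGroupoid H] in
/-- Two points of a range fibre with the same image differ by a measure-preserving left translation
that is compatible with `π`. -/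
theorem IsFiberwiseGroupoidCovering.exists_translation
    (hπ : IsFiberwiseGroupoidCovering π) [T2Space (units G)]
    (hinv : ∀ x : G, (lamG ⟨dom x, dom_mem_units x⟩).map (leftMul x) =
      (lamG ⟨rng x, rng_mem_units x⟩).map Subtype.val)
    {u : units G} {v : units H} (h : π u = v) (a a' : RFiber (u : G))
    (haa' : hπ.hom.fiberMap h a = hπ.hom.fiberMap h a') :
    ∃ θ : RFiber (u : G) → RFiber (u : G), Continuous θ ∧ Function.Injective θ ∧
      (∀ z, hπ.hom.fiberMap h (θ z) = hπ.hom.fiberMap h z) ∧ θ a = a' ∧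
      (lamG u).map θ = lamG u := by
  have hπa : π a.1 = π a'.1 := congrArg Subtype.val haa'
  have hdom : dom a'.1 = dom a.1 := hπ.dom_eq (by rw [hπa])
  let g : G := mul a'.1 (inv a.1) (hdom.trans (rng_inv _).symm)
  have hd : dom g = u := (dom_mul _ _ _).trans ((dom_inv _).trans a.2)
  have hr : rng g = u := (rng_mul _ _ _).trans a'.2
  have hga : mul g a.1 (hd.trans a.2.symm) = a'.1 := inv_mul_cancel_right _ _ hdom
  have hπg : π g = v := by
    have hda : dom (π g) = rng (π a.1) := by
      rw [← hπ.hom.map_dom, ← hπ.hom.map_rng, hd, a.2]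
    rw [← mul_inv_cancel_right (π g) (π a.1) hda,
      mul_congr (((hπ.hom.map_mul g a.1 _).symm.trans (congrArg π hga)).trans hπa.symm) rfl _
        (rng_inv _).symm, mul_inv_self]
    exact (hπ.hom.fiberMap h a).2
  let θ : RFiber (u : G) → RFiber (u : G) := fun z =>
    ⟨mul g z.1 (hd.trans z.2.symm), (rng_mul _ _ _).trans hr⟩
  have hθ : Continuous θ := (continuous_mul_of continuous_const continuous_subtype_val
    fun z => hd.trans z.2.symm).subtype_mk _
  refine ⟨θ, hθ, fun z z' hz => Subtype.ext (mul_left_cancel _ _ (congrArg Subtype.val hz)),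
    fun z => Subtype.ext ?_, Subtype.ext hga, ?_⟩
  · have hz := (hπ.hom.fiberMap h z).2
    refine (hπ.hom.map_mul g z.1 _).trans ?_
    refine (mul_congr hπg rfl _ (Eq.trans v.2 hz.symm)).trans (rng_mul_eq v.2 hz.symm)
  · have hval := (isClosedEmbedding_rFiber u).measurableEmbedding
    have hm := map_mul_eq_of_left_invariant hinv hd hr
    have h' : ((lamG u).map θ).map Subtype.val = (lamG u).map Subtype.val := by
      rw [Measure.map_map measurable_subtype_coe hθ.measurable]
      exact hm
    rw [← hval.comap_map ((lamG u).map θ), h', hval.comap_map]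

omit [IsTopGroupoid H] in
theorem IsFiberwiseGroupoidCovering.exists_fiberwisePreserves_right
    (hπ : IsFiberwiseGroupoidCovering π) [SecondCountableTopology H] [T2Space (units G)]
    (hinv : ∀ x : G, (lamG ⟨dom x, dom_mem_units x⟩).map (leftMul x) =
      (lamG ⟨rng x, rng_mem_units x⟩).map Subtype.val) :
    ∃ lamH : ∀ v : units H, Measure (RFiber (v : H)), FiberwisePreserves hπ.hom lamG lamH := by
  have h := fun v : units H => LocallyPreserves.exists_descent
    (hπ.fiberMap_isLocalHomeomorph (hπ.unitsHomeomorph_symm_apply v))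
    (hπ.fiberMap_surjective (hπ.unitsHomeomorph_symm_apply v))
    (lamG (hπ.unitsHomeomorph.symm v)) (hπ.exists_translation hinv _)
  choose lamH hlam using h
  refine ⟨lamH, fun u v h => ?_⟩
  obtain rfl : hπ.unitsHomeomorph.symm v = u :=
    hπ.unitsHomeomorph.symm_apply_eq.mpr (Subtype.ext h.symm)
  exact hlam v

end HaarTransfer

end

theorem mainTheorem5 {G H : Type*}
    [TopologicalSpace G] [AlgGroupoid G] [IsTopGroupoid G] [MeasurableSpace G] [BorelSpace G]
    [TopologicalSpace H] [AlgGroupoid H] [IsTopGroupoid H] [MeasurableSpace H] [BorelSpace H]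
    (π : G → H) (hπ : IsFiberwiseGroupoidCovering π) :
    (∀ lamH : ∀ v : AlgGroupoid.units H, MeasureTheory.Measure (AlgGroupoid.RFiber (v : H)),
      SecondCountableTopology G → IsLocallyCompactGroupoid H → IsHaarSystem lamH →
        IsLocallyCompactGroupoid G ∧
          ∃ lamG : ∀ u : AlgGroupoid.units G, MeasureTheory.Measure (AlgGroupoid.RFiber (u : G)),
            IsHaarSystem lamG ∧ IntertwinesHaar hπ.hom lamG lamH) ∧
    (∀ lamG : ∀ u : AlgGroupoid.units G, MeasureTheory.Measure (AlgGroupoid.RFiber (u : G)),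
      IsLocallyCompactGroupoid G → IsHaarSystem lamG →
        IsLocallyCompactGroupoid H ∧
          ∃ lamH : ∀ v : AlgGroupoid.units H, MeasureTheory.Measure (AlgGroupoid.RFiber (v : H)),
            IsHaarSystem lamH ∧ IntertwinesHaar hπ.hom lamG lamH) := by
  constructor
  · intro lamH _ hlcH hlam
    obtain ⟨_, _, hH⟩ := exists_countable_compact_t2_basis_iff.mp hlcH.basis
    have hG := hπ.isLocalHomeomorph.isLocallyT2_left hH
    have := hπ.isLocalHomeomorph.locallyCompactSpace_left
    have := hG.t1Space
    have := hlcH.units_t2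
    have := hlcH.units_locallyCompact
    have : T2Space (units G) := hπ.unitsHomeomorph.symm.t2Space
    obtain ⟨lamG, hp⟩ := hπ.exists_fiberwisePreserves_left lamH
    have hlamG := hp.isHaarSystem_left hπ hG hH hlam
    exact ⟨⟨inferInstance, hπ.unitsHomeomorph.isOpenEmbedding.locallyCompactSpace, inferInstance,
      exists_countable_compact_t2_basis_iff.mpr ⟨inferInstance, inferInstance, hG⟩,
      locallyCompactSpace_rFiber, t2Space_rFiber, lamG, hlamG⟩,
      lamG, hlamG, hp.intertwinesHaar hπ⟩
  · intro lamG hlcG hlam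
    obtain ⟨_, _, hG⟩ := exists_countable_compact_t2_basis_iff.mp hlcG.basis
    have hquot := hπ.isLocalHomeomorph.isOpenQuotientMap hπ.surjective
    have hH := hπ.isLocalHomeomorph.isLocallyT2_right hπ.surjective hG
    have : LocallyCompactSpace H := hquot.locallyCompactSpace
    have : SecondCountableTopology H :=
      hquot.isQuotientMap.secondCountableTopology hquot.isOpenMap
    have := hH.t1Space
    have := hlcG.units_t2
    have := hlcG.units_locallyCompact
    have : T2Space (units H) := hπ.unitsHomeomorph.t2Space
    have hinv := (left_invariant_iff hG fun u => (hlam.regular u).1).mp hlam.left_invariant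
    obtain ⟨lamH, hp⟩ := hπ.exists_fiberwisePreserves_right hinv
    have hlamH := hp.isHaarSystem_right hπ hG hH hlam
    exact ⟨⟨inferInstance, hπ.unitsHomeomorph.symm.isOpenEmbedding.locallyCompactSpace,
      inferInstance, exists_countable_compact_t2_basis_iff.mpr ⟨inferInstance, inferInstance, hH⟩,
      locallyCompactSpace_rFiber, t2Space_rFiber, lamH, hlamH⟩,
      lamH, hlamH, hp.intertwinesHaar hπ⟩
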